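/- There are absolute constants $C>0$ and $k\in\mathbb{N}$ such that for every nonempty finite set $\Sigma$, every integer $n\ge 0$ and every $\varepsilon>0$ there is an $(\varepsilon,\tfrac13)$ subcube-conditional uniformity tester for arbitrary joint distributions on $\Sigma^n$ that makes, on every execution path, at most $$C\,\frac{n^3}{\varepsilon^3}\,\Bigl(\log\bigl(2+\tfrac n\varepsilon\bigr)\Bigr)^k=\tilde O(n^3/\varepsilon^3)$$ queries, a bound that does not depend on $|\Sigma|$. Here the subcube conditional oracle of a probability distribution $\mu$ on $\Sigma^n$ takes nonempty sets $A_1,\dots,A_n\subseteq\Sigma$, puts $A=A_1\times\dots\times A_n$, and returns, independently of all previous calls, $x\in A$ with probability $\mu(x)/\mu(A)$ if $\mu(A)>0$, and a uniformly random element of $A$ if $\mu(A)=0$. An $(\varepsilon,\delta)$ subcube-conditional uniformity tester is a randomized algorithm that adaptively queries this oracle (each query may depend on the previous answers and on internal coin tosses) and then accepts or rejects, such that for every probability distribution $\mu$ on $\Sigma^n$ (no independence of the coordinates is assumed): if $\mu$ is the uniform distribution $\mathcal U$ on $\Sigma^n$, it accepts with probability at least $1-\delta$; if $d(\mu,\mathcal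 U):=\frac12\sum_{x\in\Sigma^n}|\mu(x)-\mathcal U(x)|\ge\varepsilon$, it rejects with probability at least $1-\delta$. The tester may depend on $\Sigma$, $n$ and $\varepsilon$, but not on $\mu$. -/

import Mathlib

/-- Total variation distance of two distributions on a finite set:
half the `ℓ¹` distance of the probability mass functions. -/
noncomputable def tvDist {Ω : Type*} [Fintype Ω] (μ ν : PMF Ω) : ℝ :=
  (1 / 2) * ∑ x, |(μ x).toReal - (ν x).toReal|

open Classical in
/-- The law of one answer of the subcube conditional oracle of `μ` to the query
`A = A₁ × ⋯ × Aₙ` (nonempty): `μ` conditioned on `A` if `μ(A) > 0`, and the uniform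
distribution on `A` if `μ(A) = 0`. -/
noncomputable def subCond {α : Type*} {n : ℕ} (μ : PMF (Fin n → α))
    (A : Fin n → Finset α) (hA : ∀ i, (A i).Nonempty) : PMF (Fin n → α) :=
  if h : ∃ x ∈ (Fintype.piFinset A : Set (Fin n → α)), x ∈ μ.support then
    μ.filter (Fintype.piFinset A : Set (Fin n → α)) h
  else
    PMF.uniformOfFinset (Fintype.piFinset A) (Fintype.piFinset_nonempty.2 hA)

/-- A randomized adaptive algorithm with access to a subcube conditional oracle over `αⁿ`,
as a decision tree. It either stops with a verdict (`true` is acceptance), or tosses a fair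
internal coin with `m + 1` sides, or queries the oracle with a nonempty subcube
`A₁ × ⋯ × Aₙ`; in the last two cases it goes on depending on the outcome, so every action
depends on the whole transcript and on the previous coin tosses. -/
inductive SubCondAlgorithm (α : Type*) (n : ℕ) where
  | output (verdict : Bool) : SubCondAlgorithm α n
  | toss (m : ℕ) (next : Fin (m + 1) → SubCondAlgorithm α n) : SubCondAlgorithm α n
  | query (A : Fin n → Finset α) (hA : ∀ i, (A i).Nonempty)
      (next : (Fin n → α) → SubCondAlgorithm α n) : SubCondAlgorithm α n

namespace SubCondAlgorithm

/-- The largest number of oracle queries on any execution path. -/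
def numQueries {α : Type*} [Fintype α] {n : ℕ} : SubCondAlgorithm α n → ℕ
  | output _ => 0
  | toss _ next => Finset.univ.sup fun i => (next i).numQueries
  | query _ _ next => 1 + Finset.univ.sup fun x => (next x).numQueries

/-- The law of the verdict when the oracle is that of `μ`. The coin tosses and the answers
of the oracle are fresh, that is, independent of everything that happened before. -/
noncomputable def run {α : Type*} {n : ℕ} (μ : PMF (Fin n → α)) :
    SubCondAlgorithm α n → PMF Bool
  | output b => PMF.pure b
  | toss m next => (PMF.uniformOfFintype (Fin (m + 1))).bind fun i => (next i).run μ
  | query A hA next => (subCond μ A hA).bind fun x => (next x).run μ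

/-- `T` is an `(ε, δ)` subcube conditional tester for the property `P` of distributions on
`αⁿ`, with conditional sample complexity at most `t`. -/
def IsTester {α : Type*} [Fintype α] {n : ℕ} (T : SubCondAlgorithm α n)
    (P : Set (PMF (Fin n → α))) (ε δ t : ℝ) : Prop :=
  (T.numQueries : ℝ) ≤ t ∧
  (∀ μ ∈ P, 1 - δ ≤ (T.run μ true).toReal) ∧
  (∀ μ, (∀ ν ∈ P, ε ≤ tvDist μ ν) → 1 - δ ≤ (T.run μ false).toReal)

/-- An `(ε, δ)` subcube conditional uniformity tester over `αⁿ`. -/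
def IsUniformityTester {α : Type*} [Fintype α] [Nonempty α] {n : ℕ}
    (T : SubCondAlgorithm α n) (ε δ t : ℝ) : Prop :=
  T.IsTester {PMF.uniformOfFintype (Fin n → α)} ε δ t

end SubCondAlgorithm

/-! Pass from the uniform distribution to `μ` through hybrids: the k-th has its first k coordinates
from `μ` and uniform ones after them. The distance to uniform is at most the sum of the distances
between consecutive hybrids. At coordinate i (counted from 0), this compares the mass p of a prefix
of length i + 1 with the average over y of the masses p' obtained by replacing its last symbol by y.
Always (p - p')⁺ ≤ 2p · ((p - p') / (p + p'))⁺. For y ≠ x i the quotient is the `bias` of a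
conditional query that fixes the earlier coordinates and allows only two symbols at i, and the
weight p amounts to drawing x from `μ`. Hence, if `μ` is ε-far from uniform, the positive part of
the bias has mean at least ε/(2n) over random i, y and x (`tvDist_uniform_le_sum_bias`), whatever
the alphabet size. For the uniform distribution every bias is 0.

A round tests one random bias against b = ε/(4n) with about (n/ε)² log(n/ε) queries. Its rejection
probability is bounded below linearly in the bias (`half_bias_sub_le`), so the mean alone gives
rejection with probability at least ε/(8n) (`le_toReal_run_round_false`). About 16n/ε rounds then
suffice, with error at most 1/(3M) in each of the M rounds on uniform input. -/

namespace PMF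

/-! ### Finite probability sums and an exponential moment bound -/

theorem toReal_sum_eq_one {β : Type*} [Fintype β] (p : PMF β) : ∑ x, (p x).toReal = 1 := by
  rw [← ENNReal.toReal_sum fun x _ => p.apply_ne_top x, ← tsum_fintype (L := .unconditional β),
    p.tsum_coe]
  simp

theorem toReal_bind_apply {β γ : Type*} [Fintype β] (p : PMF β) (f : β → PMF γ) (c : γ) :
    ((p.bind f) c).toReal = ∑ x, (p x).toReal * (f x c).toReal := by
  rw [PMF.bind_apply, tsum_fintype,
    ENNReal.toReal_sum fun x _ => ENNReal.mul_ne_top (p.apply_ne_top x) ((f x).apply_ne_top c)]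
  simp

/-- A weak form of Hoeffding's lemma. -/
theorem sum_exp_le {β : Type*} [Fintype β] (p : PMF β) (X : β → ℝ) (hX : ∀ z, |X z| ≤ 1)
    (l : ℝ) (hl : |l| ≤ 1) :
    ∑ z, (p z).toReal * Real.exp (l * X z) ≤
      Real.exp (l * ∑ z, (p z).toReal * X z + l ^ 2) := by
  -- For |u| ≤ 1, exp u ≤ 1 + u + u²; the quadratic term costs at most l².
  have key : ∀ z, Real.exp (l * X z) ≤ 1 + l * X z + l ^ 2 := fun z => by
    have h1 : |l * X z| ≤ 1 := by
      rw [abs_mul]; exact mul_le_one₀ hl (abs_nonneg _) (hX z)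
    have h2 := (abs_le.1 (Real.abs_exp_sub_one_sub_id_le h1)).2
    have h3 : X z ^ 2 ≤ 1 := (sq_le_one_iff_abs_le_one _).2 (hX z)
    have h4 : (l * X z) ^ 2 ≤ l ^ 2 := by
      rw [mul_pow]; exact mul_le_of_le_one_right (sq_nonneg _) h3
    linarith
  calc ∑ z, (p z).toReal * Real.exp (l * X z)
      ≤ ∑ z, (p z).toReal * (1 + l * X z + l ^ 2) :=
        Finset.sum_le_sum fun z _ => mul_le_mul_of_nonneg_left (key z) ENNReal.toReal_nonneg
    _ = (1 + l ^ 2) * ∑ z, (p z).toReal + l * ∑ z, (p z).toReal * X z := by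
        rw [Finset.mul_sum, Finset.mul_sum, ← Finset.sum_add_distrib]
        exact Finset.sum_congr rfl fun z _ => by ring
    _ = (l * ∑ z, (p z).toReal * X z + l ^ 2) + 1 := by rw [toReal_sum_eq_one]; ring
    _ ≤ _ := Real.add_one_le_exp _

end PMF

/-! ### Total variation distance -/

/-- Both masses total 1, so the positive and negative parts of the difference have equal sums. -/
theorem tvDist_eq_sum_posPart {Ω : Type*} [Fintype Ω] (μ ν : PMF Ω) :
    tvDist μ ν = ∑ x, max ((μ x).toReal - (ν x).toReal) 0 := by
  have h : ∑ x, ((μ x).toReal - (ν x).toReal) = 0 := by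
    rw [Finset.sum_sub_distrib, PMF.toReal_sum_eq_one, PMF.toReal_sum_eq_one, sub_self]
  have h2 : ∑ x, |(μ x).toReal - (ν x).toReal| =
      2 * ∑ x, max ((μ x).toReal - (ν x).toReal) 0 - ∑ x, ((μ x).toReal - (ν x).toReal) := by
    rw [Finset.mul_sum, ← Finset.sum_sub_distrib]
    refine Finset.sum_congr rfl fun x _ => ?_
    rcases le_total 0 ((μ x).toReal - (ν x).toReal) with h | h
    · rw [abs_of_nonneg h, max_eq_left h]; ring
    · rw [abs_of_nonpos h, max_eq_right h]; ring
  rw [tvDist, h2, h]; ring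

theorem tvDist_le_one {Ω : Type*} [Fintype Ω] (μ ν : PMF Ω) : tvDist μ ν ≤ 1 := by
  rw [tvDist_eq_sum_posPart, ← PMF.toReal_sum_eq_one μ]
  refine Finset.sum_le_sum fun x _ => max_le ?_ ENNReal.toReal_nonneg
  linarith [(ENNReal.toReal_nonneg : 0 ≤ (ν x).toReal)]

theorem tvDist_of_subsingleton {Ω : Type*} [Fintype Ω] [Subsingleton Ω] (μ ν : PMF Ω) :
    tvDist μ ν = 0 := by
  have h : ∀ (p : PMF Ω) (x : Ω), (p x).toReal = 1 := fun p x => by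
    rw [← PMF.toReal_sum_eq_one p]
    exact (Fintype.sum_eq_single (f := fun y => (p y).toReal) x
      fun y hy => absurd (Subsingleton.elim y x) hy).symm
  simp [tvDist, h]

/-! ### Prefix masses and the hybrid argument -/

section Prefix

variable {α : Type*} [Fintype α] {n : ℕ}

open Classical in
/-- The mass under `μ` of the set of points that agree with `x` on the first `k` coordinates. -/
noncomputable def prefixMass (μ : PMF (Fin n → α)) (k : ℕ) (x : Fin n → α) : ℝ :=
  ∑ z, if ∀ j : Fin n, j.1 < k → z j = x j then (μ z).toReal else 0

theorem prefixMass_nonneg (μ : PMF (Fin n → α)) (k : ℕ) (x : Fin n → α) :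
    0 ≤ prefixMass μ k x :=
  Finset.sum_nonneg fun z _ => by split_ifs <;> simp

theorem prefixMass_zero (μ : PMF (Fin n → α)) (x : Fin n → α) : prefixMass μ 0 x = 1 := by
  simp [prefixMass, PMF.toReal_sum_eq_one]

theorem prefixMass_self (μ : PMF (Fin n → α)) (x : Fin n → α) :
    prefixMass μ n x = (μ x).toReal := by
  classical
  have h : ∀ z : Fin n → α, (∀ j : Fin n, j.1 < n → z j = x j) ↔ z = x := fun z =>
    ⟨fun h => funext fun j => h j j.2, fun h j _ => h ▸ rfl⟩
  simp only [prefixMass, h, Finset.sum_ite_eq', Finset.mem_univ, if_true]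

open Classical in
theorem agree_update_iff {α : Type*} {n : ℕ} (i : Fin n) (x z : Fin n → α) (y : α) :
    (∀ j : Fin n, j.1 < i.1 + 1 → z j = Function.update x i y j) ↔
      (∀ j : Fin n, j.1 < i.1 → z j = x j) ∧ z i = y := by
  constructor
  · intro h
    refine ⟨fun j hj => ?_, by simpa using h i (Nat.lt_succ_self _)⟩
    have := h j (Nat.lt_succ_of_lt hj)
    rwa [Function.update_of_ne (Fin.ne_of_lt hj)] at this
  · rintro ⟨h, hi⟩ j hj
    rcases eq_or_ne j i with rfl | hne
    · simpa using hi
    · rw [Function.update_of_ne hne]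
      exact h j (lt_of_le_of_ne (Nat.lt_succ_iff.1 hj) fun e => hne (Fin.ext e))

open Classical in
theorem sum_prefixMass_update (μ : PMF (Fin n → α)) (i : Fin n) (x : Fin n → α) :
    ∑ y, prefixMass μ (i.1 + 1) (Function.update x i y) = prefixMass μ i.1 x := by
  simp only [prefixMass]
  rw [Finset.sum_comm]
  refine Finset.sum_congr rfl fun z _ => ?_
  simp only [agree_update_iff, ite_and]
  split_ifs
  · simp
  · simp

open Classical in
theorem card_agree (k : ℕ) (z : Fin n → α) :
    (Finset.univ.filter fun x : Fin n → α => ∀ j : Fin n, j.1 < k → z j = x j).card =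
      Fintype.card α ^ (n - k) := by
  have h : (Finset.univ.filter fun x : Fin n → α => ∀ j : Fin n, j.1 < k → z j = x j) =
      Fintype.piFinset fun j : Fin n => if j.1 < k then {z j} else Finset.univ := by
    ext x
    simp only [Finset.mem_filter, Finset.mem_univ, true_and, Fintype.mem_piFinset]
    refine forall_congr' fun j => ?_
    split_ifs with hj <;> simp [hj, eq_comm]
  have h2 : ∀ j : Fin n, (if j.1 < k then {z j} else (Finset.univ : Finset α)).card =
      if k ≤ j.1 then Fintype.card α else 1 := fun j => by
    by_cases hj : j.1 < k
    · simp [hj]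
    · simp [hj, not_lt.1 hj]
  rw [h, Fintype.card_piFinset]
  simp only [h2]
  rw [Finset.prod_ite, Finset.prod_const, Finset.prod_const_one, mul_one]
  congr 1
  rw [← Finset.card_map Fin.valEmbedding]
  have : (Finset.univ.filter fun j : Fin n => k ≤ j.1).map Fin.valEmbedding = Finset.Ico k n := by
    ext m
    simp only [Finset.mem_map, Finset.mem_filter, Finset.mem_univ, true_and,
      Fin.valEmbedding_apply, Finset.mem_Ico]
    exact ⟨by rintro ⟨j, hj, rfl⟩; exact ⟨hj, j.2⟩, fun h => ⟨⟨m, h.2⟩, h.1, rfl⟩⟩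
  rw [this, Nat.card_Ico]

theorem prefixMass_uniform [Nonempty α] (k : ℕ) (x x' : Fin n → α) :
    prefixMass (PMF.uniformOfFintype (Fin n → α)) k x =
      prefixMass (PMF.uniformOfFintype (Fin n → α)) k x' := by
  classical
  have h : ∀ x : Fin n → α, prefixMass (PMF.uniformOfFintype (Fin n → α)) k x =
      (Fintype.card α ^ (n - k) : ℕ) * (((Fintype.card (Fin n → α) : ENNReal))⁻¹).toReal :=
    fun x => by
      rw [← card_agree k x]
      simp only [prefixMass, PMF.uniformOfFintype_apply]
      rw [← Finset.sum_filter, Finset.sum_const, nsmul_eq_mul]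
      simp only [eq_comm]
  rw [h, h]

/-- Averaging over `μ` a function of the first `k` coordinates. -/
theorem sum_prefixMass_mul (μ : PMF (Fin n → α)) (k : ℕ) (f : (Fin n → α) → ℝ)
    (hf : ∀ x x' : Fin n → α, (∀ j : Fin n, j.1 < k → x j = x' j) → f x = f x') :
    ∑ x, prefixMass μ k x * f x = (Fintype.card α : ℝ) ^ (n - k) * ∑ x, (μ x).toReal * f x := by
  classical
  simp only [prefixMass, Finset.sum_mul]
  rw [Finset.sum_comm, Finset.mul_sum]
  refine Finset.sum_congr rfl fun z _ => ?_
  -- Each sample z is counted once for every x sharing its first k coordinates, and `f` does not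
  -- distinguish these x.
  have : ∀ x : Fin n → α,
      (if ∀ j : Fin n, j.1 < k → z j = x j then (μ z).toReal else 0) * f x =
      if ∀ j : Fin n, j.1 < k → z j = x j then (μ z).toReal * f z else 0 := fun x => by
    split_ifs with h
    · rw [hf z x h]
    · simp
  simp only [this]
  rw [← Finset.sum_filter, Finset.sum_const, card_agree k, nsmul_eq_mul, Nat.cast_pow]

open Classical in
/-- The chain rule: the distance to uniform is at most the sum over the coordinates of the
distances between consecutive hybrids, which have a prefix from `μ` and are uniform after it. -/
theorem tvDist_uniform_le_sum [Nonempty α] (μ : PMF (Fin n → α)) :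
    tvDist μ (PMF.uniformOfFintype (Fin n → α)) ≤
      ∑ i : Fin n, ∑ x, (∑ y, max (prefixMass μ (i.1 + 1) x -
        prefixMass μ (i.1 + 1) (Function.update x i y)) 0) /
          (Fintype.card α : ℝ) ^ (n - i.1) := by
  set N : ℝ := (Fintype.card α : ℝ)
  have hN : 0 < N := Nat.cast_pos.2 Fintype.card_pos
  -- The mass function of the k-th hybrid: g 0 is uniform and g n is `μ`.
  let g : ℕ → (Fin n → α) → ℝ := fun k x => prefixMass μ k x / N ^ (n - k)
  have hstep : ∀ (i : Fin n) (x : Fin n → α), max (g (i.1 + 1) x - g i.1 x) 0 ≤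
      (∑ y, max (prefixMass μ (i.1 + 1) x -
        prefixMass μ (i.1 + 1) (Function.update x i y)) 0) / N ^ (n - i.1) := by
    intro i x
    have hpow : N ^ (n - i.1) = N * N ^ (n - (i.1 + 1)) := by
      rw [← pow_succ']; congr 1; have := i.2; omega
    refine max_le ?_ (div_nonneg (Finset.sum_nonneg fun y _ => le_max_right _ _) (by positivity))
    -- The shorter prefix mass is the sum over y of the longer ones, so the increment is an average
    -- over y of pairwise differences.
    calc g (i.1 + 1) x - g i.1 x
        = (∑ y, (prefixMass μ (i.1 + 1) x -
            prefixMass μ (i.1 + 1) (Function.update x i y))) / N ^ (n - i.1) := by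
          rw [Finset.sum_sub_distrib, sum_prefixMass_update, Finset.sum_const, nsmul_eq_mul,
            Finset.card_univ]
          simp only [g]
          rw [hpow]
          field_simp
          rfl
      _ ≤ _ := by
          gcongr with y
          exact le_max_left _ _
  have htel : ∀ x, (μ x).toReal - (PMF.uniformOfFintype (Fin n → α) x).toReal =
      ∑ i : Fin n, (g (i.1 + 1) x - g i.1 x) := fun x => by
    rw [Fin.sum_univ_eq_sum_range (fun i => g (i + 1) x - g i x), Finset.sum_range_sub fun k => g k x]
    simp [g, prefixMass_self, prefixMass_zero, N]
  rw [tvDist_eq_sum_posPart, Finset.sum_comm]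
  refine Finset.sum_le_sum fun x _ => ?_
  rw [htel]
  refine max_le (Finset.sum_le_sum fun i _ => (le_max_left _ _).trans (hstep i x))
    (Finset.sum_nonneg fun i _ => (le_max_right _ _).trans (hstep i x))

end Prefix

namespace SubCondAlgorithm

/-! ### Composition, repetition and internal randomness -/

section Sequencing

variable {α : Type*} {n : ℕ}

theorem run_true_add_run_false (μ : PMF (Fin n → α)) (T : SubCondAlgorithm α n) :
    (T.run μ true).toReal + (T.run μ false).toReal = 1 := by
  simpa using PMF.toReal_sum_eq_one (T.run μ)

/-- Run `T`; if it accepts, run `S`, and otherwise reject. -/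
def andThen : SubCondAlgorithm α n → SubCondAlgorithm α n → SubCondAlgorithm α n
  | output true, S => S
  | output false, _ => output false
  | toss m next, S => toss m fun i => (next i).andThen S
  | query A hA next, S => query A hA fun x => (next x).andThen S

theorem run_andThen_true (μ : PMF (Fin n → α)) (T S : SubCondAlgorithm α n) :
    (T.andThen S).run μ true = T.run μ true * S.run μ true := by
  induction T with
  | output b => cases b <;> simp [andThen, run]
  | toss m next ih =>
    simp only [andThen, run, PMF.bind_apply, ih, ← ENNReal.tsum_mul_right, mul_assoc]
  | query A hA next ih =>
    simp only [andThen, run, PMF.bind_apply, ih, ← ENNReal.tsum_mul_right, mul_assoc]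

theorem numQueries_andThen_le [Fintype α] (T S : SubCondAlgorithm α n) :
    (T.andThen S).numQueries ≤ T.numQueries + S.numQueries := by
  induction T with
  | output b => cases b <;> simp [andThen, numQueries]
  | toss m next ih =>
    simp only [andThen, numQueries]
    refine Finset.sup_le fun i hi => (ih i).trans ?_
    gcongr
    exact Finset.le_sup (f := fun i => (next i).numQueries) hi
  | query A hA next ih =>
    simp only [andThen, numQueries, add_assoc]
    gcongr
    refine Finset.sup_le fun i hi => (ih i).trans ?_
    gcongr
    exact Finset.le_sup (f := fun i => (next i).numQueries) hi

/-- Run `T` independently `k` times and accept if all runs accept. -/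
def allOf (T : SubCondAlgorithm α n) : ℕ → SubCondAlgorithm α n
  | 0 => output true
  | k + 1 => T.andThen (T.allOf k)

theorem run_allOf_true (μ : PMF (Fin n → α)) (T : SubCondAlgorithm α n) (k : ℕ) :
    (T.allOf k).run μ true = T.run μ true ^ k := by
  induction k with
  | zero => simp [allOf, run]
  | succ k ih => rw [allOf, run_andThen_true, ih, pow_succ']

theorem numQueries_allOf_le [Fintype α] (T : SubCondAlgorithm α n) (k : ℕ) :
    (T.allOf k).numQueries ≤ k * T.numQueries := by
  induction k with
  | zero => simp [allOf, numQueries]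
  | succ k ih =>
    rw [allOf, Nat.succ_mul, Nat.add_comm]
    exact (numQueries_andThen_le _ _).trans (Nat.add_le_add_left ih _)

/-- Draw a uniform element of `β` with an internal coin. -/
noncomputable def draw (β : Type*) [Fintype β] [Nonempty β] (next : β → SubCondAlgorithm α n) :
    SubCondAlgorithm α n :=
  toss (Fintype.card β - 1) fun i => next ((Fintype.equivFin β).symm
    (Fin.cast (Nat.sub_add_cancel Fintype.card_pos) i))

theorem toReal_run_draw (μ : PMF (Fin n → α)) {β : Type*} [Fintype β] [Nonempty β]
    (next : β → SubCondAlgorithm α n) (b : Bool) :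
    ((draw β next).run μ b).toReal =
      (∑ y, ((next y).run μ b).toReal) / Fintype.card β := by
  have hc : Fintype.card β - 1 + 1 = Fintype.card β := Nat.sub_add_cancel Fintype.card_pos
  rw [draw, run, PMF.toReal_bind_apply, div_eq_inv_mul, Finset.mul_sum,
    ← Equiv.sum_comp ((finCongr hc).trans (Fintype.equivFin β).symm)]
  refine Finset.sum_congr rfl fun i _ => ?_
  rw [PMF.uniformOfFintype_apply, Fintype.card_fin, ENNReal.toReal_inv, ENNReal.toReal_natCast,
    show ((Fintype.card β - 1 + 1 : ℕ) : ℝ) = Fintype.card β from congrArg _ hc]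
  rfl

theorem numQueries_draw_le [Fintype α] {β : Type*} [Fintype β] [Nonempty β]
    (next : β → SubCondAlgorithm α n) (t : ℕ) (h : ∀ y, (next y).numQueries ≤ t) :
    (draw β next).numQueries ≤ t := by
  rw [draw, numQueries]
  exact Finset.sup_le fun i _ => h _

end Sequencing

/-! ### Threshold tests and their Chernoff bound -/

section Count

variable {α : Type*} {n : ℕ}

/-- Query the subcube `A` `t` times, add the values of `X` at the answers to `s`, and accept
if the sum is less than `θ`. -/
noncomputable def count (A : Fin n → Finset α) (hA : ∀ i, (A i).Nonempty)
    (X : (Fin n → α) → ℝ) (θ : ℝ) : ℕ → ℝ → SubCondAlgorithm α n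
  | 0, s => output (decide (s < θ))
  | t + 1, s => query A hA fun z => count A hA X θ t (s + X z)

variable [Fintype α]

theorem numQueries_count_le (A : Fin n → Finset α) (hA : ∀ i, (A i).Nonempty)
    (X : (Fin n → α) → ℝ) (θ : ℝ) (t : ℕ) (s : ℝ) : (count A hA X θ t s).numQueries ≤ t := by
  induction t generalizing s with
  | zero => simp [count, numQueries]
  | succ t ih =>
    rw [count, numQueries, Nat.add_comm]
    exact Nat.succ_le_succ (Finset.sup_le fun z _ => ih _)

/-- The Chernoff bound for both verdicts of `count`: a value `l ≥ 0` bounds the probability of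
rejection, a value `l ≤ 0` that of acceptance. -/
theorem toReal_run_count_le (μ : PMF (Fin n → α)) (A : Fin n → Finset α)
    (hA : ∀ i, (A i).Nonempty) (X : (Fin n → α) → ℝ) (hX : ∀ z, |X z| ≤ 1) (θ l : ℝ)
    (hl : |l| ≤ 1) (b : Bool) (hb : ∀ s, decide (s < θ) = b → 0 ≤ l * (s - θ)) (t : ℕ) (s : ℝ) :
    ((count A hA X θ t s).run μ b).toReal ≤
      Real.exp (l * (s - θ) + t * (l * ∑ z, (subCond μ A hA z).toReal * X z + l ^ 2)) := by
  classical
  -- Each answer multiplies the exponential moment by at most exp(l · mean + l²); at the leaf, `hb`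
  -- is Markov's inequality for the verdict.
  induction t generalizing s with
  | zero =>
    rw [count, run, PMF.pure_apply]
    split_ifs with h
    · simpa using hb s h.symm
    · simpa using (Real.exp_pos _).le
  | succ t ih =>
    rw [count, run, PMF.toReal_bind_apply]
    obtain ⟨B, hB⟩ : ∃ B, B = ∑ z, (subCond μ A hA z).toReal * X z := ⟨_, rfl⟩
    rw [← hB] at ih ⊢
    calc ∑ z, (subCond μ A hA z).toReal * ((count A hA X θ t (s + X z)).run μ b).toReal
        ≤ ∑ z, (subCond μ A hA z).toReal *
            Real.exp (l * (s + X z - θ) + t * (l * B + l ^ 2)) :=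
          Finset.sum_le_sum fun z _ => mul_le_mul_of_nonneg_left (ih _) ENNReal.toReal_nonneg
      _ = Real.exp (l * (s - θ) + t * (l * B + l ^ 2)) *
            ∑ z, (subCond μ A hA z).toReal * Real.exp (l * X z) := by
          rw [Finset.mul_sum]
          refine Finset.sum_congr rfl fun z _ => ?_
          rw [mul_left_comm, ← Real.exp_add]
          congr 2
          ring
      _ ≤ Real.exp (l * (s - θ) + t * (l * B + l ^ 2)) * Real.exp (l * B + l ^ 2) :=
          by
          rw [hB]
          exact mul_le_mul_of_nonneg_left (PMF.sum_exp_le _ X hX l hl) (Real.exp_pos _).le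
      _ = _ := by
          rw [← Real.exp_add]
          congr 1
          push_cast
          ring

end Count

/-! ### Pair queries and one round of the tester -/

section Round

variable {α : Type*} [Fintype α] {n : ℕ}

open Classical in
/-- The subcube that fixes the first coordinates as in `x` and restricts coordinate `i`
to `x i` and `y`. -/
noncomputable def pairCube (i : Fin n) (x : Fin n → α) (y : α) (j : Fin n) : Finset α :=
  if j < i then {x j} else if j = i then {x i, y} else Finset.univ

theorem pairCube_nonempty (i : Fin n) (x : Fin n → α) (y : α) (j : Fin n) :
    (pairCube i x y j).Nonempty := by
  classical
  refine ⟨x j, ?_⟩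
  unfold pairCube
  split_ifs with h1 h2 <;> simp [*]

theorem mem_pairCube_iff (i : Fin n) (x z : Fin n → α) (y : α) :
    z ∈ Fintype.piFinset (pairCube i x y) ↔
      (∀ j : Fin n, j.1 < i.1 → z j = x j) ∧ (z i = x i ∨ z i = y) := by
  classical
  rw [Fintype.mem_piFinset]
  constructor
  · intro h
    refine ⟨fun j hj => ?_, by simpa [pairCube] using h i⟩
    have := h j
    rw [pairCube, if_pos (show j < i from hj)] at this
    simpa using this
  · rintro ⟨h1, h2⟩ j
    unfold pairCube
    split_ifs with hj hj2
    · simpa using h1 j hj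
    · subst hj2; simpa using h2
    · simp

open Classical in
/-- `1` for the answers with value `a` at coordinate `i`, minus `1` for those with value `y`. -/
noncomputable def pairSign (i : Fin n) (a y : α) (z : Fin n → α) : ℝ :=
  (if z i = a then 1 else 0) - (if z i = y then 1 else 0)

theorem abs_pairSign_le {α : Type*} {n : ℕ} (i : Fin n) (a y : α) (z : Fin n → α) : |pairSign i a y z| ≤ 1 := by
  unfold pairSign
  split_ifs <;> simp

/-- The mean of `pairSign` over the answers to the pair query. -/
noncomputable def bias (μ : PMF (Fin n → α)) (i : Fin n) (x : Fin n → α) (y : α) : ℝ :=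
  ∑ z, (subCond μ (pairCube i x y) (pairCube_nonempty i x y) z).toReal * pairSign i (x i) y z

open Classical in
-- The witness c is the mass of the pair cube, by which conditioning divides. It is only bounded by
-- the sum of the two prefix masses because they coincide when y = x i. Positivity of the prefix
-- mass rules out the default uniform answer.
theorem exists_bias_mul_eq (μ : PMF (Fin n → α)) (i : Fin n) (x : Fin n → α) (y : α)
    (hx : 0 < prefixMass μ (i.1 + 1) x) :
    ∃ c : ℝ, 0 < c ∧
      c ≤ prefixMass μ (i.1 + 1) x + prefixMass μ (i.1 + 1) (Function.update x i y) ∧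
      bias μ i x y * c =
        prefixMass μ (i.1 + 1) x - prefixMass μ (i.1 + 1) (Function.update x i y) := by
  have hag : ∀ z : Fin n → α, (∀ j : Fin n, j.1 < i.1 + 1 → z j = x j) ↔
      (∀ j : Fin n, j.1 < i.1 → z j = x j) ∧ z i = x i := fun z => by
    simpa using agree_update_iff i x z (x i)
  set S : Set (Fin n → α) := (Fintype.piFinset (pairCube i x y) : Set (Fin n → α)) with hS
  have hmem : ∀ z, z ∈ S ↔
      (∀ j : Fin n, j.1 < i.1 → z j = x j) ∧ (z i = x i ∨ z i = y) := fun z => by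
    rw [hS, Finset.mem_coe, mem_pairCube_iff]
  have hsupp : ∃ z ∈ S, z ∈ μ.support := by
    obtain ⟨z, -, hz⟩ := Finset.exists_ne_zero_of_sum_ne_zero hx.ne'
    split_ifs at hz with h
    · refine ⟨z, (hmem z).2 ⟨((hag z).1 h).1, Or.inl ((hag z).1 h).2⟩, ?_⟩
      intro h0
      exact hz (by simp [h0])
    · exact absurd rfl hz
  have hq : subCond μ (pairCube i x y) (pairCube_nonempty i x y) = μ.filter S hsupp :=
    dif_pos hsupp
  set c : ℝ := ∑ z, if z ∈ S then (μ z).toReal else 0 with hc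
  have hind : ∀ z, (S.indicator μ z).toReal = if z ∈ S then (μ z).toReal else 0 := fun z => by
    rw [Set.indicator_apply]; split_ifs <;> simp
  have hc' : (∑' z, S.indicator μ z).toReal = c := by
    rw [tsum_fintype, ENNReal.toReal_sum, hc]
    · exact Finset.sum_congr rfl fun z _ => hind z
    · intro z _
      rw [Set.indicator_apply]
      split_ifs
      · exact μ.apply_ne_top z
      · simp
  have hcpos : 0 < c := by
    refine hx.trans_le (Finset.sum_le_sum fun z _ => ?_)
    by_cases h : ∀ j : Fin n, j.1 < i.1 + 1 → z j = x j
    · rw [if_pos h, if_pos ((hmem z).2 ⟨((hag z).1 h).1, Or.inl ((hag z).1 h).2⟩)]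
    · rw [if_neg h]; split_ifs <;> simp
  refine ⟨c, hcpos, ?_, ?_⟩
  · simp only [hc, prefixMass]
    rw [← Finset.sum_add_distrib]
    refine Finset.sum_le_sum fun z _ => ?_
    simp only [hag, agree_update_iff, hmem]
    have := (ENNReal.toReal_nonneg : 0 ≤ (μ z).toReal)
    split_ifs <;> first | linarith | tauto
  · have : bias μ i x y * c =
        ∑ z, (if z ∈ S then (μ z).toReal else 0) * pairSign i (x i) y z := by
      rw [bias, Finset.sum_mul]
      refine Finset.sum_congr rfl fun z _ => ?_
      rw [hq, PMF.filter_apply, ENNReal.toReal_mul, ENNReal.toReal_inv, hc', hind]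
      field_simp
    rw [this]
    simp only [prefixMass]
    rw [← Finset.sum_sub_distrib]
    refine Finset.sum_congr rfl fun z _ => ?_
    simp only [hag, agree_update_iff, hmem, pairSign]
    have aux : ∀ (P Q R : Prop) (m : ℝ),
        (if P ∧ (Q ∨ R) then m else 0) * ((if Q then 1 else 0) - (if R then 1 else 0)) =
          (if P ∧ Q then m else 0) - (if P ∧ R then m else 0) := fun P Q R m => by
      by_cases hP : P <;> by_cases hQ : Q <;> by_cases hR : R <;> simp [hP, hQ, hR]
    convert aux _ _ _ _

theorem bias_uniform [Nonempty α] (i : Fin n) (x : Fin n → α) (y : α) :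
    bias (PMF.uniformOfFintype (Fin n → α)) i x y = 0 := by
  classical
  have hx : 0 < prefixMass (PMF.uniformOfFintype (Fin n → α)) (i.1 + 1) x := by
    refine Finset.sum_pos' (fun z _ => by split_ifs <;> simp) ⟨x, Finset.mem_univ _, ?_⟩
    simp only [implies_true, if_true, PMF.uniformOfFintype_apply]
    rw [ENNReal.toReal_inv]
    have : 0 < Fintype.card (Fin n → α) := Fintype.card_pos
    rw [ENNReal.toReal_natCast]
    positivity
  obtain ⟨c, hc, -, h⟩ := exists_bias_mul_eq _ i x y hx
  rw [prefixMass_uniform (i.1 + 1) (Function.update x i y) x, sub_self] at h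
  exact (mul_eq_zero.1 h).resolve_right hc.ne'

open Classical in
-- When the difference is positive, the prefix of x is the heavier of the two, so the cube has mass
-- at most twice that of this prefix.
theorem posPart_sub_le_mul_bias (μ : PMF (Fin n → α)) (i : Fin n) (x : Fin n → α) (y : α) :
    max (prefixMass μ (i.1 + 1) x - prefixMass μ (i.1 + 1) (Function.update x i y)) 0 ≤
      2 * (prefixMass μ (i.1 + 1) x * max (bias μ i x y) 0) := by
  have h0 := prefixMass_nonneg μ (i.1 + 1) x
  have h1 := prefixMass_nonneg μ (i.1 + 1) (Function.update x i y)
  have h2 : 0 ≤ max (bias μ i x y) 0 := le_max_right _ _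
  refine max_le ?_ (by positivity)
  rcases le_or_gt (prefixMass μ (i.1 + 1) x)
    (prefixMass μ (i.1 + 1) (Function.update x i y)) with h | h
  · exact (sub_nonpos.2 h).trans (by positivity)
  · obtain ⟨c, hc, hle, heq⟩ := exists_bias_mul_eq μ i x y (h1.trans_lt h)
    rw [← heq]
    calc bias μ i x y * c ≤ max (bias μ i x y) 0 * c := by gcongr; exact le_max_left _ _
      _ ≤ max (bias μ i x y) 0 * (2 * prefixMass μ (i.1 + 1) x) := by gcongr; linarith
      _ = _ := by ring

/-- `t` pair queries, with rejection if the average sign is at least `b / 2`. -/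
noncomputable def pairTest (b : ℝ) (t : ℕ) (i : Fin n) (x : Fin n → α) (y : α) :
    SubCondAlgorithm α n :=
  count (pairCube i x y) (pairCube_nonempty i x y) (pairSign i (x i) y) (t * (b / 2)) t 0

theorem toReal_run_pairTest_false_le (μ : PMF (Fin n → α)) {b : ℝ} (hb : 0 < b) (hb1 : b ≤ 1)
    (t : ℕ) (i : Fin n) (x : Fin n → α) (y : α) (h : bias μ i x y = 0) :
    ((pairTest b t i x y).run μ false).toReal ≤ Real.exp (-(t * (b ^ 2 / 16))) := by
  -- l = b/4 minimizes the exponent -l · tb/2 + t l², with minimum -t b²/16.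
  refine (toReal_run_count_le μ _ _ _ (abs_pairSign_le i (x i) y) _ (b / 4)
    (by rw [abs_of_pos (by positivity)]; linarith) false (fun s hs => ?_) t 0).trans
    (Real.exp_le_exp.2 (le_of_eq ?_))
  · have : t * (b / 2) ≤ s := by simpa using hs
    exact mul_nonneg (by positivity) (by linarith)
  · change _ + _ * (_ * bias μ i x y + _) = _
    rw [h]; ring

theorem toReal_run_pairTest_true_le (μ : PMF (Fin n → α)) {b : ℝ} (hb : 0 < b) (hb1 : b ≤ 1)
    (t : ℕ) (i : Fin n) (x : Fin n → α) (y : α) (h : b ≤ bias μ i x y) :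
    ((pairTest b t i x y).run μ true).toReal ≤ Real.exp (-(t * (b ^ 2 / 16))) := by
  refine (toReal_run_count_le μ _ _ _ (abs_pairSign_le i (x i) y) _ (-(b / 4))
    (by rw [abs_neg, abs_of_pos (by positivity)]; linarith) true (fun s hs => ?_) t 0).trans
    (Real.exp_le_exp.2 ?_)
  · have : s < t * (b / 2) := by simpa using hs
    exact mul_nonneg_of_nonpos_of_nonpos (by linarith) (by linarith)
  · change _ + _ * (_ * bias μ i x y + _) ≤ _
    have ht : (0 : ℝ) ≤ t := t.cast_nonneg
    have : (t : ℝ) * (b / 4 * b) ≤ t * (b / 4 * bias μ i x y) := by gcongr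
    nlinarith

/-- One round of the tester: choose a coordinate `i`, a sample `x` and a symbol `y`, and
compare `x i` with `y` given the prefix of `x`. -/
noncomputable def round [Nonempty α] [NeZero n] (b : ℝ) (t : ℕ) : SubCondAlgorithm α n :=
  draw (Fin n) fun i => draw α fun y =>
    query (fun _ => Finset.univ) (fun _ => Finset.univ_nonempty) fun x => pairTest b t i x y

theorem numQueries_round_le [Nonempty α] [NeZero n] (b : ℝ) (t : ℕ) :
    (round b t : SubCondAlgorithm α n).numQueries ≤ 1 + t := by
  refine numQueries_draw_le _ _ fun i => numQueries_draw_le _ _ fun y => ?_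
  rw [numQueries]
  gcongr
  exact Finset.sup_le fun x _ => numQueries_count_le _ _ _ _ _ _

theorem subCond_univ [Nonempty α] (μ : PMF (Fin n → α)) :
    subCond μ (fun _ => Finset.univ) (fun _ => Finset.univ_nonempty) = μ := by
  classical
  have h : ∃ x ∈ ((Fintype.piFinset fun _ : Fin n => (Finset.univ : Finset α) :
      Finset (Fin n → α)) : Set (Fin n → α)), x ∈ μ.support := by
    obtain ⟨x, hx⟩ := μ.support_nonempty
    exact ⟨x, by simp, hx⟩
  rw [subCond, dif_pos h]
  ext x
  have hsum : ∑ z, μ z = 1 := by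
    rw [← tsum_fintype (L := .unconditional _), μ.tsum_coe]
  simp [PMF.filter_apply, hsum]

theorem toReal_run_round [Nonempty α] [NeZero n] (μ : PMF (Fin n → α)) (b : ℝ) (t : ℕ) (v : Bool) :
    ((round b t : SubCondAlgorithm α n).run μ v).toReal =
      (∑ i : Fin n, (∑ y : α, ∑ x, (μ x).toReal * ((pairTest b t i x y).run μ v).toReal) /
        Fintype.card α) / n := by
  rw [round, toReal_run_draw, Fintype.card_fin]
  congr 1
  refine Finset.sum_congr rfl fun i _ => ?_
  rw [toReal_run_draw]
  congr 1
  refine Finset.sum_congr rfl fun y _ => ?_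
  rw [run, PMF.toReal_bind_apply, subCond_univ]

theorem toReal_run_round_uniform_le [Nonempty α] [NeZero n] {b : ℝ} (hb : 0 < b) (hb1 : b ≤ 1) (t : ℕ) :
    ((round b t : SubCondAlgorithm α n).run (PMF.uniformOfFintype (Fin n → α)) false).toReal ≤
      Real.exp (-(t * (b ^ 2 / 16))) := by
  have hn : (0 : ℝ) < n := Nat.cast_pos.2 (Nat.pos_of_neZero n)
  have hN : (0 : ℝ) < Fintype.card α := Nat.cast_pos.2 Fintype.card_pos
  rw [toReal_run_round, div_le_iff₀ hn]
  refine (Finset.sum_le_card_nsmul _ _ (Real.exp (-(t * (b ^ 2 / 16)))) fun i _ => ?_).trans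
    (by simp [mul_comm])
  rw [div_le_iff₀ hN]
  refine (Finset.sum_le_card_nsmul _ _ (Real.exp (-(t * (b ^ 2 / 16)))) fun y _ => ?_).trans
    (by simp [mul_comm])
  refine (Finset.sum_le_sum fun x _ => mul_le_mul_of_nonneg_left
    (toReal_run_pairTest_false_le _ hb hb1 t i x y (bias_uniform i x y))
    ENNReal.toReal_nonneg).trans ?_
  rw [← Finset.sum_mul, PMF.toReal_sum_eq_one, one_mul]

/-- Below the threshold the left side is at most 0; above it rejection has probability at least 1/2,
while the bias is at most 1. Linearity in the bias lets expectations be taken directly, without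
sorting biases by size. -/
theorem half_bias_sub_le (μ : PMF (Fin n → α)) {b : ℝ} (hb : 0 < b) (hb1 : b ≤ 1)
    (t : ℕ) (ht : Real.exp (-(t * (b ^ 2 / 16))) ≤ 1 / 2) (i : Fin n) (x : Fin n → α) (y : α) :
    (max (bias μ i x y) 0 - b) / 2 ≤ ((pairTest b t i x y).run μ false).toReal := by
  have h0 : 0 ≤ ((pairTest b t i x y).run μ false).toReal := ENNReal.toReal_nonneg
  rcases lt_or_ge (bias μ i x y) b with h | h
  · have : max (bias μ i x y) 0 ≤ b := max_le h.le hb.le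
    linarith
  · have h1 := toReal_run_pairTest_true_le μ hb hb1 t i x y h
    have h2 := run_true_add_run_false μ (pairTest b t i x y)
    have h3 : bias μ i x y ≤ 1 := by
      rw [bias, ← PMF.toReal_sum_eq_one (subCond μ (pairCube i x y) (pairCube_nonempty i x y))]
      exact Finset.sum_le_sum fun z _ => mul_le_of_le_one_right ENNReal.toReal_nonneg
        (abs_le.1 (abs_pairSign_le _ _ _ z)).2
    have : max (bias μ i x y) 0 ≤ 1 := max_le h3 zero_le_one
    linarith

/-- This locality lets `sum_prefixMass_mul` turn prefix weights into an average over `μ`. -/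
theorem bias_congr (μ : PMF (Fin n → α)) (i : Fin n) (y : α) {x x' : Fin n → α}
    (h : ∀ j : Fin n, j.1 < i.1 + 1 → x j = x' j) : bias μ i x y = bias μ i x' y := by
  classical
  have h1 : pairCube i x y = pairCube i x' y := by
    funext j
    unfold pairCube
    split_ifs with hj
    · rw [h j (Nat.lt_succ_of_lt hj)]
    · rw [h i (Nat.lt_succ_self _)]
    · rfl
  have h2 : x i = x' i := h i (Nat.lt_succ_self _)
  unfold bias
  simp only [h1, h2]

theorem tvDist_uniform_le_sum_bias [Nonempty α] (μ : PMF (Fin n → α)) :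
    tvDist μ (PMF.uniformOfFintype (Fin n → α)) ≤
      2 * ∑ i : Fin n, (∑ y : α, ∑ x, (μ x).toReal * max (bias μ i x y) 0) /
        Fintype.card α := by
  classical
  have hN : (0 : ℝ) < Fintype.card α := Nat.cast_pos.2 Fintype.card_pos
  refine (tvDist_uniform_le_sum μ).trans ?_
  rw [Finset.mul_sum]
  refine Finset.sum_le_sum fun i _ => ?_
  have hpow : (Fintype.card α : ℝ) ^ (n - i.1) =
      (Fintype.card α : ℝ) ^ (n - (i.1 + 1)) * Fintype.card α := by
    rw [← pow_succ]; congr 1; have := i.2; omega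
  rw [← Finset.sum_div, Finset.sum_comm, hpow, ← div_div, mul_div_assoc']
  gcongr
  rw [div_le_iff₀ (by positivity), Finset.mul_sum, Finset.sum_mul]
  refine Finset.sum_le_sum fun y _ => ?_
  calc ∑ x, max (prefixMass μ (i.1 + 1) x - prefixMass μ (i.1 + 1) (Function.update x i y)) 0
      ≤ ∑ x, 2 * (prefixMass μ (i.1 + 1) x * max (bias μ i x y) 0) :=
        Finset.sum_le_sum fun x _ => posPart_sub_le_mul_bias μ i x y
    _ = _ := by
        rw [← Finset.mul_sum, sum_prefixMass_mul μ (i.1 + 1) (fun x => max (bias μ i x y) 0)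
          fun x x' h => by rw [bias_congr μ i y h]]
        ring

theorem le_toReal_run_round_false [Nonempty α] [NeZero n] (μ : PMF (Fin n → α)) {b : ℝ} (hb : 0 < b)
    (hb1 : b ≤ 1) (t : ℕ) (ht : Real.exp (-(t * (b ^ 2 / 16))) ≤ 1 / 2) :
    tvDist μ (PMF.uniformOfFintype (Fin n → α)) / (4 * n) - b / 2 ≤
      ((round b t : SubCondAlgorithm α n).run μ false).toReal := by
  have hn : (0 : ℝ) < n := Nat.cast_pos.2 (Nat.pos_of_neZero n)
  have hN : (0 : ℝ) < Fintype.card α := Nat.cast_pos.2 Fintype.card_pos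
  have htv := tvDist_uniform_le_sum_bias μ
  set E := ∑ i : Fin n, (∑ y : α, ∑ x, (μ x).toReal * max (bias μ i x y) 0) / Fintype.card α
  have key : E / 2 - n * (b / 2) ≤ ∑ i : Fin n,
      (∑ y : α, ∑ x, (μ x).toReal * ((pairTest b t i x y).run μ false).toReal) /
        Fintype.card α := by
    have h1 : E / 2 - n * (b / 2) =
        ∑ i : Fin n, (∑ y : α, ∑ x, (μ x).toReal * ((max (bias μ i x y) 0 - b) / 2)) /
          Fintype.card α := by
      have h2 : ∀ (i : Fin n) (y : α), ∑ x, (μ x).toReal * ((max (bias μ i x y) 0 - b) / 2) =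
          (∑ x, (μ x).toReal * max (bias μ i x y) 0) / 2 - b / 2 := fun i y => by
        have : b / 2 = ∑ x, (μ x).toReal * (b / 2) := by
          rw [← Finset.sum_mul, PMF.toReal_sum_eq_one, one_mul]
        rw [this, Finset.sum_div, ← Finset.sum_sub_distrib]
        exact Finset.sum_congr rfl fun x _ => by ring
      have h3 : ∀ i : Fin n,
          (∑ y : α, ∑ x, (μ x).toReal * ((max (bias μ i x y) 0 - b) / 2)) / Fintype.card α =
          (∑ y : α, ∑ x, (μ x).toReal * max (bias μ i x y) 0) / Fintype.card α / 2 - b / 2 :=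
        fun i => by
          rw [Finset.sum_congr rfl fun y _ => h2 i y, Finset.sum_sub_distrib, ← Finset.sum_div,
            Finset.sum_const, Finset.card_univ, nsmul_eq_mul]
          field_simp
      rw [Finset.sum_congr rfl fun i _ => h3 i, Finset.sum_sub_distrib, ← Finset.sum_div,
        Finset.sum_const, Finset.card_univ, nsmul_eq_mul, Fintype.card_fin]
    rw [h1]
    gcongr with i _ y _ x _
    exact half_bias_sub_le μ hb hb1 t ht i x y
  rw [toReal_run_round, le_div_iff₀ hn]
  refine le_trans ?_ key
  have : (tvDist μ (PMF.uniformOfFintype (Fin n → α)) / (4 * n) - b / 2) * n =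
      tvDist μ (PMF.uniformOfFintype (Fin n → α)) / 4 - n * (b / 2) := by
    field_simp
  rw [this]
  linarith

end Round

/-! ### Amplification and choice of parameters -/

theorem isUniformityTester_output_true {α : Type*} [Fintype α] [Nonempty α] {n : ℕ} {ε t : ℝ}
    (ht : 0 ≤ t) (h : ∀ μ : PMF (Fin n → α), tvDist μ (PMF.uniformOfFintype (Fin n → α)) < ε) :
    (output true : SubCondAlgorithm α n).IsUniformityTester ε (1 / 3) t := by
  refine ⟨by simpa [numQueries] using ht, fun μ _ => by simp [run], fun μ hμ => ?_⟩
  exact absurd (hμ _ rfl) (not_le.2 (h μ))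

theorem isUniformityTester_allOf_round {α : Type*} [Fintype α] [Nonempty α] {n : ℕ} [NeZero n]
    {ε : ℝ} (hε : 0 < ε) (hε1 : ε ≤ 1) (M t : ℕ) (hM : 16 * (n / ε) ≤ M)
    (ht : 256 * (n / ε) ^ 2 * Real.log (3 * M) ≤ t) :
    ((round (ε / (4 * n)) t : SubCondAlgorithm α n).allOf M).IsUniformityTester ε (1 / 3)
      (M * (1 + t)) := by
  have hn : (1 : ℝ) ≤ n := Nat.one_le_cast.2 (Nat.pos_of_neZero n)
  have hn0 : (0 : ℝ) < n := by linarith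
  have hr : 1 ≤ n / ε := (one_le_div hε).2 (hε1.trans hn)
  have hM1 : (1 : ℝ) ≤ M := by linarith
  set b := ε / (4 * n) with hb_def
  have hb : 0 < b := by positivity
  have hb1 : b ≤ 1 := (div_le_one (by positivity)).2 (by linarith)
  -- Here b²/16 = (ε/n)²/256, whence the 256 in `ht`. The bound allows a union over M rounds.
  have hexp : Real.exp (-(t * (b ^ 2 / 16))) ≤ 1 / (3 * M) := by
    rw [one_div, ← Real.exp_log (show 0 < (3 * (M : ℝ))⁻¹ by positivity), Real.log_inv]
    refine Real.exp_le_exp.2 (neg_le_neg ?_)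
    calc Real.log (3 * M) = 256 * (n / ε) ^ 2 * Real.log (3 * M) * (b ^ 2 / 16) := by
          rw [hb_def]; field_simp; ring
      _ ≤ _ := by gcongr
  refine ⟨?_, fun μ hμ => ?_, fun μ hμ => ?_⟩
  · have := (numQueries_allOf_le (round b t : SubCondAlgorithm α n) M).trans
      (Nat.mul_le_mul_left M (numQueries_round_le b t))
    exact_mod_cast this
  · rw [Set.mem_singleton_iff.1 hμ, run_allOf_true, ENNReal.toReal_pow]
    have h1 := toReal_run_round_uniform_le (α := α) (n := n) hb hb1 t
    have h2 := run_true_add_run_false (PMF.uniformOfFintype (Fin n → α)) (round b t)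
    set f := ((round b t).run (PMF.uniformOfFintype (Fin n → α)) false).toReal
    have h3 : f ≤ 1 / (3 * M) := h1.trans hexp
    have hfM : M * f ≤ 1 / 3 := by
      calc M * f ≤ M * (1 / (3 * M)) := by gcongr
        _ = 1 / 3 := by field_simp
    have h4 : (1 : ℝ) / (3 * M) ≤ 1 := (div_le_one (by positivity)).2 (by linarith)
    rw [show ((round b t).run (PMF.uniformOfFintype (Fin n → α)) true).toReal = 1 + -f by linarith]
    -- Bernoulli's inequality: (1 - f)^M ≥ 1 - M f ≥ 2/3.
    refine le_trans ?_ (one_add_mul_le_pow (by linarith) M)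
    linarith
  · have hd : ε ≤ tvDist μ (PMF.uniformOfFintype (Fin n → α)) := hμ _ rfl
    have h0 := run_true_add_run_false μ ((round b t).allOf M)
    suffices h : (((round b t).allOf M).run μ true).toReal ≤ 1 / 3 by linarith
    rw [run_allOf_true, ENNReal.toReal_pow]
    have h1 := le_toReal_run_round_false μ hb hb1 t (hexp.trans
      (one_div_le_one_div_of_le two_pos (by linarith)))
    have h2 := run_true_add_run_false μ (round b t)
    have h3 : ε / (8 * n) ≤ ((round b t).run μ false).toReal := by
      refine le_trans ?_ h1
      have : ε / (4 * n) ≤ tvDist μ (PMF.uniformOfFintype (Fin n → α)) / (4 * n) := by gcongr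
      have e : ε / (8 * n) = ε / (4 * n) - b / 2 := by rw [hb_def]; field_simp; norm_num
      linarith
    have h4 : ((round b t).run μ true).toReal ≤ Real.exp (-(ε / (8 * n))) := by
      have := Real.add_one_le_exp (-(ε / (8 * n)))
      linarith
    calc ((round b t).run μ true).toReal ^ M
        ≤ Real.exp (-(ε / (8 * n))) ^ M := pow_le_pow_left₀ ENNReal.toReal_nonneg h4 M
      _ = Real.exp (-(M * (ε / (8 * n)))) := by rw [← Real.exp_nat_mul]; congr 1; ring
      _ ≤ Real.exp (-2) := by
          refine Real.exp_le_exp.2 (neg_le_neg ?_)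
          calc (2 : ℝ) = 16 * (n / ε) * (ε / (8 * n)) := by field_simp; norm_num
            _ ≤ _ := by gcongr
      _ ≤ 1 / 3 := by
          rw [Real.exp_neg, one_div]
          refine inv_anti₀ (by norm_num) ?_
          have := Real.add_one_le_exp (2 : ℝ)
          linarith

theorem IsUniformityTester.mono {α : Type*} [Fintype α] [Nonempty α] {n : ℕ}
    {T : SubCondAlgorithm α n} {ε δ t t' : ℝ} (h : T.IsUniformityTester ε δ t) (ht : t ≤ t') :
    T.IsUniformityTester ε δ t' :=
  ⟨h.1.trans ht, h.2⟩

end SubCondAlgorithm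

theorem mainTheorem5 :
    ∃ (C : ℝ) (k : ℕ), 0 < C ∧ ∀ (α : Type*) [Fintype α] [Nonempty α] (n : ℕ) (ε : ℝ), 0 < ε →
      ∃ T : SubCondAlgorithm α n,
        T.IsUniformityTester ε (1 / 3)
          (C * ((n : ℝ) ^ 3 / ε ^ 3) * Real.log (2 + (n : ℝ) / ε) ^ k) := by
  refine ⟨100000, 1, by norm_num, fun α _ _ n ε hε => ?_⟩
  have hlog : 0 ≤ Real.log (2 + (n : ℝ) / ε) :=
    Real.log_nonneg (by have : 0 ≤ (n : ℝ) / ε := by positivity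
                        linarith)
  have hbound : 0 ≤ 100000 * ((n : ℝ) ^ 3 / ε ^ 3) * Real.log (2 + (n : ℝ) / ε) ^ 1 := by
    positivity
  -- For n = 0 no query is allowed, and for ε > 1 the bound may be below one query; in both cases no
  -- distribution is ε-far, so accepting is correct.
  rcases Nat.eq_zero_or_pos n with rfl | hn
  · exact ⟨_, SubCondAlgorithm.isUniformityTester_output_true hbound fun μ => by
      rwa [tvDist_of_subsingleton]⟩
  rcases lt_or_ge 1 ε with hε1 | hε1
  · exact ⟨_, SubCondAlgorithm.isUniformityTester_output_true hbound fun μ =>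
      (tvDist_le_one _ _).trans_lt hε1⟩
  have : NeZero n := ⟨hn.ne'⟩
  refine ⟨_, (SubCondAlgorithm.isUniformityTester_allOf_round hε hε1 ⌈16 * (n / ε)⌉₊ _
    (Nat.le_ceil _) (Nat.le_ceil _)).mono ?_⟩
  set r : ℝ := n / ε with hr_def
  set L := Real.log (2 + r)
  set M := ⌈16 * r⌉₊
  have hr : 1 ≤ r := (one_le_div hε).2 (hε1.trans (Nat.one_le_cast.2 hn))
  -- 2 + r ≥ 3 > e; this and r ≥ 1 absorb the rounding terms.
  have hL : 1 ≤ L := by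
    rw [Real.le_log_iff_exp_le (by linarith)]
    linarith [Real.exp_one_lt_d9]
  have hM : (M : ℝ) ≤ 17 * r := by
    have := Nat.ceil_lt_add_one (show 0 ≤ 16 * r by linarith)
    linarith
  have hM0 : (0 : ℝ) < M := lt_of_lt_of_le (by linarith) (Nat.le_ceil (16 * r))
  -- 3M ≤ 51r ≤ 3⁴(2 + r) ≤ (2 + r)⁵.
  have hlogM : Real.log (3 * M) ≤ 5 * L := by
    rw [show 5 * L = Real.log ((2 + r) ^ 5) by rw [Real.log_pow]; norm_num [L]]
    refine Real.log_le_log (by positivity) ?_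
    have h3 : (3 : ℝ) ^ 4 ≤ (2 + r) ^ 4 := pow_le_pow_left₀ (by norm_num) (by linarith) 4
    calc 3 * (M : ℝ) ≤ 3 ^ 4 * (2 + r) := by linarith
      _ ≤ (2 + r) ^ 4 * (2 + r) := by gcongr
      _ = (2 + r) ^ 5 := by ring
  have hlogM0 : 0 ≤ Real.log (3 * M) := Real.log_nonneg (by linarith [Nat.le_ceil (16 * r)])
  have hr2L : 1 ≤ r ^ 2 * L := one_le_mul_of_one_le_of_one_le (one_le_pow₀ hr) hL
  have ht : (⌈256 * r ^ 2 * Real.log (3 * M)⌉₊ : ℝ) ≤ 1281 * (r ^ 2 * L) := by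
    have h1 := Nat.ceil_lt_add_one (show 0 ≤ 256 * r ^ 2 * Real.log (3 * M) by positivity)
    have h2 : 256 * r ^ 2 * Real.log (3 * M) ≤ 256 * r ^ 2 * (5 * L) := by gcongr
    linarith
  calc (M : ℝ) * (1 + ⌈256 * r ^ 2 * Real.log (3 * M)⌉₊)
      ≤ 17 * r * (1282 * (r ^ 2 * L)) := by gcongr; linarith
    _ = 21794 * (r ^ 3 * L) := by ring
    _ ≤ 100000 * (r ^ 3 * L) := by gcongr; norm_num
    _ = 100000 * ((n : ℝ) ^ 3 / ε ^ 3) * L ^ 1 := by rw [hr_def, div_pow]; ring
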